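/- Let $\mathbb F=x_1x_2x_3\cdots=abaababa\cdots$ be the Fibonacci sequence, the fixed point beginning with $a$ of the morphism $\sigma(a)=ab$, $\sigma(b)=a$. Let $f_{-2}=0$, $f_{-1}=f_0=1$ and $f_{m+1}=f_m+f_{m-1}$ for $m\ge 0$. For $n\ge 0$ let $A(n)$ be the number of occurrences of nonempty palindromes in $\mathbb F$ that end at position $n$, i.e. the number of $i$ with $1\le i\le n$ such that $x_i\cdots x_n$ is a palindrome (so $A(0)=0$), and let $B(n)=\sum_{i=1}^n A(i)$ be the number of palindrome occurrences in $x_1\cdots x_n$, counted with repetition. Let $n\ge 1$ and let $m$ be such that $f_m\le n+1<f_{m+1}$. Then $$\sum_{i=f_m-1}^{n}A(i)=\begin{cases}\displaystyle\sum_{i=f_{m-2}-1}^{n-f_{m-1}}A(i)+n-f_m+2, & n+1<2f_{m-1},\\[2mm] \displaystyle\sum_{i=f_{m-1}-1}^{n-f_{m-1}}A(i)+n+\frac{m-11}{5}f_{m-1}+\frac{m+1}{5}f_{m-3}+2, & \text{otherwise.}\end{cases}$$ The sum on the right is again of the same form: with $n'=n-f_{m-1}$ one has $f_{m-2}\le n'+1<f_{m-1}$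 in the first case and $f_{m-1}\le n'+1<f_m$ in the second. Write $S(m,n)$ for the value returned by the recursive procedure that returns $0$ if $m=0$, returns $1$ if $m=1$, and for $m\ge 2$ calls itself once, on $(m-2,n')$ in the first case and on $(m-1,n')$ in the second, and adds the remaining terms of the formula above. Then $S(m,n)=\sum_{i=f_m-1}^{n}A(i)$ and $$B(n)=\frac{m-3}{5}f_{m+2}+\frac{m-1}{5}f_m+2+S(m,n),$$ and the computation of $S(m,n)$ makes at most $m\le 2\lfloor\log_2(n+1)\rfloor$ recursive calls. -/

import Mathlib

namespace FibPal

/-- The two-letter alphabet `{a, b}`. -/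
inductive Letter
  | a
  | b
  deriving DecidableEq

/-- The Fibonacci numbers in the indexing `f₋₁ = f₀ = 1`, `f₁ = 2`, `f₂ = 3`, `f₃ = 5`, ….
Extending the recursion one step backwards gives `f₋₂ = 0`; smaller indices are never used. -/
def fibNum (m : ℤ) : ℕ := Nat.fib (m + 2).toNat

theorem fibNum_neg_two : fibNum (-2) = 0 := rfl

theorem fibNum_neg_one : fibNum (-1) = 1 := rfl

theorem fibNum_zero : fibNum 0 = 1 := rfl

theorem fibNum_add_one (m : ℤ) (hm : -1 ≤ m) :
    fibNum (m + 1) = fibNum m + fibNum (m - 1) := by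
  obtain ⟨k, hk⟩ := Int.eq_ofNat_of_zero_le (show 0 ≤ m + 1 by omega)
  have h1 : (m + 1 + 2).toNat = k + 2 := by omega
  have h2 : (m + 2).toNat = k + 1 := by omega
  have h3 : (m - 1 + 2).toNat = k := by omega
  simp only [fibNum, h1, h2, h3, Nat.fib_add_two]
  omega

/-- Image of a letter under the Fibonacci morphism `a ↦ ab`, `b ↦ a`. -/
def sigmaLetter : Letter → List Letter
  | .a => [.a, .b]
  | .b => [.a]

/-- The Fibonacci morphism `σ` on words. -/
def sigma (w : List Letter) : List Letter := w.flatMap sigmaLetter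

/-- The word `F_m = σ^m(a)`. -/
def fibWord (m : ℕ) : List Letter := sigma^[m] [.a]

/-- The letter at position `i ≥ 1` of the infinite Fibonacci sequence `𝔽`, the fixed point of `σ`
starting with `a`. It is read off from `F_i`, a prefix of `𝔽` of length greater than `i`;
see `fibWord_getElem?`. (The value at `i = 0` is not used.) -/
def fibLetter (i : ℕ) : Letter := (fibWord i).getD (i - 1) .a

theorem sigma_append (u v : List Letter) : sigma (u ++ v) = sigma u ++ sigma v := by
  simp [sigma]

theorem sigma_iterate_append (k : ℕ) (u v : List Letter) :
    sigma^[k] (u ++ v) = sigma^[k] u ++ sigma^[k] v := by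
  induction k generalizing u v with
  | zero => rfl
  | succ k ih => simp only [Function.iterate_succ, Function.comp, sigma_append, ih]

theorem fibWord_add_two (m : ℕ) : fibWord (m + 2) = fibWord (m + 1) ++ fibWord m := by
  have h : ([Letter.a, Letter.b, Letter.a] : List Letter) = sigma [.a] ++ [.a] := rfl
  show sigma^[m] [.a, .b, .a] = sigma^[m] (sigma [.a]) ++ sigma^[m] [.a]
  rw [h, sigma_iterate_append]

theorem fibWord_length (m : ℕ) : (fibWord m).length = fibNum m := by
  have key : ∀ k : ℕ, (fibWord k).length = Nat.fib (k + 2) ∧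
      (fibWord (k + 1)).length = Nat.fib (k + 3) := by
    intro k
    induction k with
    | zero => exact ⟨rfl, rfl⟩
    | succ k ih =>
      refine ⟨ih.2, ?_⟩
      rw [fibWord_add_two, List.length_append, ih.1, ih.2, add_comm]
      exact (Nat.fib_add_two (n := k + 2)).symm
  have h : ((m : ℤ) + 2).toNat = m + 2 := by omega
  rw [(key m).1, fibNum, h]

theorem fibWord_prefix {k m : ℕ} (h : k ≤ m) : fibWord k <+: fibWord m := by
  induction h with
  | refl => exact List.prefix_rfl
  | @step m _ ih =>
    refine ih.trans ?_
    cases m with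
    | zero => exact ⟨[.b], rfl⟩
    | succ m => exact ⟨_, (fibWord_add_two m).symm⟩

theorem lt_fibWord_length (m : ℕ) : m < (fibWord m).length := by
  induction m with
  | zero => exact Nat.zero_lt_one
  | succ m ih =>
    cases m with
    | zero => exact Nat.one_lt_two
    | succ m =>
      rw [fibWord_add_two, List.length_append]
      have h : 0 < (fibWord m).length := by
        have h' := (fibWord_prefix (Nat.zero_le m)).length_le
        exact lt_of_lt_of_le Nat.zero_lt_one h'
      omega

/-- Every `F_m` is a prefix of the infinite sequence given by `fibLetter`. -/
theorem fibWord_getElem? (m i : ℕ) (hi : i < (fibWord m).length) :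
    (fibWord m)[i]? = some (fibLetter (i + 1)) := by
  have hlt : i < (fibWord (i + 1)).length := lt_trans (Nat.lt_succ_self i) (lt_fibWord_length _)
  have h1 : (fibWord (i + 1))[i]? = some (fibLetter (i + 1)) := by
    simp [fibLetter, List.getD_eq_getElem?_getD, hlt]
  rw [← h1]
  rcases le_total m (i + 1) with h | h
  · obtain ⟨t, ht⟩ := fibWord_prefix h
    rw [← ht, List.getElem?_append_left hi]
  · obtain ⟨t, ht⟩ := fibWord_prefix h
    rw [← ht, List.getElem?_append_left hlt]

/-- The factor `𝔽[i, j] = x_i x_{i+1} ⋯ x_j` of the Fibonacci sequence (positions start at 1). -/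
def fibFactor (i j : ℕ) : List Letter := (List.range' i (j + 1 - i)).map fibLetter

/-- `A(n)`: the number of occurrences of nonempty palindromes in `𝔽` that end at position `n`,
i.e. are suffixes of `𝔽[1, n]`. Such an occurrence is determined by its first position `i`. -/
def numPalEndingAt (n : ℕ) : ℕ :=
  ((Finset.Icc 1 n).filter fun i => (fibFactor i n).reverse = fibFactor i n).card

/-- `B(n) = A(1) + ⋯ + A(n)`: the number of palindrome occurrences in `𝔽[1, n]`, counted with
repetition. -/
def numPalOccurrences (n : ℕ) : ℕ := ∑ i ∈ Finset.Icc 1 n, numPalEndingAt i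

/-- The recursive procedure for `∑_{i = f_m - 1}^{n} A(i)`, where `f_m ≤ n + 1 < f_{m+1}`.
It returns the computed value together with the number of recursive calls made.
It never evaluates `A`, apart from the initial values `A(0) = 0` and `A(1) = 1`. -/
def recSum : ℕ → ℕ → ℚ × ℕ
  | 0, _ => (0, 0)
  | 1, _ => (1, 0)
  | m + 2, n =>
    if n + 1 < 2 * fibNum ((m : ℤ) + 1) then
      let r := recSum m (n - fibNum ((m : ℤ) + 1))
      (r.1 + n - fibNum ((m : ℤ) + 2) + 2, r.2 + 1)
    else
      let r := recSum (m + 1) (n - fibNum ((m : ℤ) + 1))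
      (r.1 + n + (((m : ℚ) + 2) - 11) / 5 * fibNum ((m : ℤ) + 1)
        + (((m : ℚ) + 2) + 1) / 5 * fibNum ((m : ℤ) - 1) + 2, r.2 + 1)

end FibPal

namespace FibPal

open Finset

/-! Everything rests on one identity, `numPalEndingAt_eq_add_one`: `A(n) = A(n - p) + 1` with `p =
f_{m-1}`. The prefix of length `n` has period `p`, so palindromic suffixes starting after `p` are
those of the prefix of length `n - p`, shifted. Exactly one more starts at or before `p`. It exists
because the prefix of length `f_{m+1} - 2` is a palindrome. It is unique because two would compose
to a translation carrying the singular word at position `p` to an earlier place, which a count of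
the letter `a` forbids (`singular_first_occurrence`).

Summing the identity gives `palCount_recurrence`, the first formula. At the ends of the Fibonacci
blocks it becomes a linear recurrence solved by `palCount_fib`; this evaluates the block by which
the second formula differs and the initial part of `B(n)`. -/

theorem fibNum_eq_fib {z : ℤ} {k : ℕ} (h : z + 2 = k) : fibNum z = Nat.fib k := by
  simp [fibNum, h]

theorem fibWord_length_eq_fib (m : ℕ) : (fibWord m).length = Nat.fib (m + 2) := by
  rw [fibWord_length, fibNum_eq_fib (k := m + 2) (by push_cast; ring)]

/-! ### Periods and palindromic prefixes of the Fibonacci sequence -/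

/-- `F_{k+1} F_k` is a prefix of the Fibonacci sequence. -/
theorem fibLetter_fib_succ_add {k t : ℕ} (hk : 2 ≤ k) (ht : 1 ≤ t) (htk : t ≤ Nat.fib k) :
    fibLetter (Nat.fib (k + 1) + t) = fibLetter t := by
  obtain ⟨k, rfl⟩ := Nat.exists_eq_add_of_le' hk
  obtain ⟨t, rfl⟩ := Nat.exists_eq_add_of_le' ht
  have h1 := fibWord_length_eq_fib (k + 1)
  have h0 := fibWord_length_eq_fib k
  have h2 : Nat.fib (k + 1) + Nat.fib (k + 2) = Nat.fib (k + 3) := Nat.fib_add_two.symm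
  have hlen : Nat.fib (k + 3) + t < (fibWord (k + 2)).length := by
    rw [fibWord_add_two, List.length_append, h1, h0]
    show Nat.fib (k + 3) + t < Nat.fib (k + 3) + _
    omega
  have e1 := fibWord_getElem? (k + 2) _ hlen
  have e2 := fibWord_getElem? k t (by omega)
  rw [fibWord_add_two, List.getElem?_append_right (by rw [h1]; exact Nat.le_add_right _ _), h1,
    show Nat.fib (k + 3) + t - Nat.fib (k + 1 + 2) = t from Nat.add_sub_cancel_left _ _, e2] at e1
  exact (Option.some.inj e1).symm

/-- The prefix of length `f - 2`, `f` a Fibonacci number, has the Fibonacci number two indices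
before `f` as a period. -/
theorem fibLetter_fib_add (k : ℕ) {t : ℕ} (ht : 1 ≤ t) (htk : t + 2 ≤ Nat.fib (k + 1)) :
    fibLetter (Nat.fib k + t) = fibLetter t := by
  induction k generalizing t with
  | zero => simp
  | succ k ih =>
    rcases lt_or_ge k 2 with hk | hk
    · interval_cases k <;> simp [Nat.fib_add_two] at htk
      omega
    have hf : Nat.fib k + Nat.fib (k + 1) = Nat.fib (k + 2) := Nat.fib_add_two.symm
    rcases le_or_gt t (Nat.fib k) with h | h
    · exact fibLetter_fib_succ_add hk ht h
    -- Beyond `F_k F_{k-1}`-type prefixes, both positions reduce to `s + 1`: one by the prefix lemma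
    -- an index higher, the other by induction.
    · obtain ⟨s, rfl⟩ := Nat.exists_eq_add_of_lt h
      have htk' : Nat.fib k + s + 1 + 2 ≤ Nat.fib (k + 2) := htk
      rw [show Nat.fib (k + 1) + (Nat.fib k + s + 1) = Nat.fib (k + 1 + 1) + (s + 1) by
          show _ = Nat.fib (k + 2) + (s + 1); omega,
        fibLetter_fib_succ_add (by omega) (by omega) (by omega), add_assoc,
        ih (by omega) (by omega)]

/-- The last letters of successive `F_k` alternate, since `F_{k+2}` ends in `F_k`. -/
theorem fibLetter_fib_ne (k : ℕ) :
    fibLetter (Nat.fib (k + 3)) ≠ fibLetter (Nat.fib (k + 2)) := by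
  induction k with
  | zero => decide
  | succ k ih =>
    have h : Nat.fib (k + 4) = Nat.fib (k + 2 + 1) + Nat.fib (k + 2) := by
      rw [Nat.fib_add_two, add_comm]
    show fibLetter (Nat.fib (k + 4)) ≠ fibLetter (Nat.fib (k + 3))
    rw [h, fibLetter_fib_succ_add (by omega) (Nat.fib_pos.2 (by omega)) le_rfl]
    exact ih.symm

/-- The prefix of length `f - 2`, `f` a Fibonacci number, is a palindrome. -/
theorem fibLetter_central (k : ℕ) {i j : ℕ} (hi : 1 ≤ i) (hj : 1 ≤ j)
    (hij : i + j + 1 = Nat.fib k) : fibLetter i = fibLetter j := by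
  induction k using Nat.strong_induction_on generalizing i j with
  | _ k ih =>
    rcases lt_or_ge k 6 with hk | hk
    · have hle : Nat.fib k ≤ Nat.fib 5 := Nat.fib_mono (by omega)
      have h5 : Nat.fib 5 = 5 := rfl
      have hi' : i ≤ 3 := by omega
      have hj' : j ≤ 3 := by omega
      interval_cases k <;> interval_cases i <;> interval_cases j <;>
        first | rfl | (exfalso; revert hij; decide)
    · obtain ⟨k, rfl⟩ := Nat.exists_eq_add_of_le' hk
      have h1 : Nat.fib (k + 4) + Nat.fib (k + 5) = Nat.fib (k + 6) := Nat.fib_add_two.symm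
      have h2 : Nat.fib (k + 3) + Nat.fib (k + 4) = Nat.fib (k + 5) := Nat.fib_add_two.symm
      have h3 : 2 ≤ Nat.fib (k + 3) := Nat.fib_mono (show 3 ≤ k + 3 by omega)
      -- One of the two mirror positions exceeds the period `fib (k + 4)`; subtracting it leaves a
      -- mirror pair for `fib (k + 5)`.
      have aux : ∀ {i j : ℕ}, 1 ≤ j → i + j + 1 = Nat.fib (k + 6) → Nat.fib (k + 4) < i →
          fibLetter i = fibLetter j := by
        intro i j hj hij hlt
        obtain ⟨s, rfl⟩ := Nat.exists_eq_add_of_lt hlt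
        rw [add_assoc, fibLetter_fib_add _ (by omega) (by
          show _ ≤ Nat.fib (k + 5); omega)]
        exact ih (k + 5) (by omega) (by omega) hj (by omega)
      rcases lt_or_ge (Nat.fib (k + 4)) i with h | h
      · exact aux hj hij h
      · exact (aux hi (by omega) (by omega)).symm

/-! ### Palindromic suffixes and the singular word -/

theorem reverse_fibFactor_eq_iff (i n : ℕ) :
    (fibFactor i n).reverse = fibFactor i n ↔
      ∀ j, i ≤ j → j ≤ n → fibLetter j = fibLetter (i + n - j) := by
  have hlen : (fibFactor i n).length = n + 1 - i := by simp [fibFactor]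
  constructor
  · intro h j hij hjn
    have hj : j - i < (fibFactor i n).length := by omega
    have e := List.getElem_reverse (l := fibFactor i n) (i := j - i) (by simpa using hj)
    simp only [h] at e
    simp only [fibFactor, List.getElem_map, List.getElem_range', List.length_map,
      List.length_range'] at e
    rw [show i + 1 * (j - i) = j by omega,
      show i + 1 * (n + 1 - i - 1 - (j - i)) = i + n - j by omega] at e
    exact e
  · intro h
    refine List.ext_getElem (by simp) fun t h1 h2 => ?_
    rw [List.getElem_reverse]
    simp only [fibFactor, List.getElem_map, List.getElem_range', List.length_map,
      List.length_range']
    rw [hlen] at h2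
    rw [h (i + 1 * t) (by omega) (by omega)]
    congr 1
    omega

/-- A window whose length is a period of the sequence, on a prefix containing it, has the letter
count of the window at the start. -/
theorem sum_window_eq {f : ℕ → ℕ} {L N : ℕ} (hf : ∀ t, 1 ≤ t → t + L ≤ N → f (L + t) = f t)
    (J : ℕ) (hJ : J + L ≤ N) :
    ∑ t ∈ range L, f (J + 1 + t) = ∑ t ∈ range L, f (1 + t) := by
  induction J with
  | zero => simp
  | succ J ih =>
    rw [← ih (by omega)]
    have h1 := sum_range_succ (fun t => f (J + 1 + t)) L
    have h2 := sum_range_succ' (fun t => f (J + 1 + t)) L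
    have h3 : f (J + 1 + L) = f (J + 1) := by
      rw [add_comm]; exact hf _ (by omega) (by omega)
    have h4 : ∑ t ∈ range L, f (J + 1 + (t + 1)) = ∑ t ∈ range L, f (J + 1 + 1 + t) :=
      sum_congr rfl fun t _ => by rw [add_comm t 1, ← add_assoc]
    simp only [add_zero] at h2
    omega

/-- The singular word occurring at position `fib (m + 1)` does not occur earlier. -/
theorem singular_first_occurrence {m J : ℕ} (hJ : 1 ≤ J) (hJp : J < Nat.fib (m + 1)) :
    ∃ t < Nat.fib m, fibLetter (J + t) ≠ fibLetter (Nat.fib (m + 1) + t) := by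
  have hm : 2 ≤ m := by
    by_contra! h
    interval_cases m <;> simp [Nat.fib_add_two] at hJp <;> omega
  by_contra! h
  obtain ⟨J, rfl⟩ := Nat.exists_eq_add_of_le' hJ
  -- Count occurrences of `a`. Windows starting before `fib (m + 1)` have the count of the prefix of
  -- length `fib m`; the singular window trades that prefix's last letter for a different one.
  set c : ℕ → ℕ := fun i => if fibLetter i = .a then 1 else 0 with hc
  have hcongr : ∀ {i j}, fibLetter i = fibLetter j → c i = c j := by
    intro i j hij; simp [hc, hij]
  have hL : 1 ≤ Nat.fib m := Nat.fib_pos.2 (by omega)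
  have e1 : ∑ t ∈ range (Nat.fib m), c (J + 1 + t) = ∑ t ∈ range (Nat.fib m), c (1 + t) :=
    sum_window_eq (N := Nat.fib m + Nat.fib (m + 1) - 2)
      (fun t ht htN => hcongr (fibLetter_fib_add m ht (by omega))) J (by omega)
  have e2 : ∑ t ∈ range (Nat.fib m), c (J + 1 + t) =
      ∑ t ∈ range (Nat.fib m), c (Nat.fib (m + 1) + t) :=
    sum_congr rfl fun t ht => hcongr (h t (mem_range.1 ht))
  have e3 := sum_range_succ (fun t => c (Nat.fib (m + 1) + t)) (Nat.fib m)
  have e4 := sum_range_succ' (fun t => c (Nat.fib (m + 1) + t)) (Nat.fib m)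
  have e5 : ∑ t ∈ range (Nat.fib m), c (Nat.fib (m + 1) + (t + 1)) =
      ∑ t ∈ range (Nat.fib m), c (1 + t) :=
    sum_congr rfl fun t ht => by
      have := mem_range.1 ht
      rw [add_comm 1 t]
      exact hcongr (fibLetter_fib_succ_add hm (by omega) (by omega))
  have e6 : c (Nat.fib (m + 1) + Nat.fib m) = c (Nat.fib m) :=
    hcongr (fibLetter_fib_succ_add hm hL le_rfl)
  have e7 : c (Nat.fib (m + 1)) = c (Nat.fib m) := by
    simp only [add_zero] at e4
    omega
  obtain ⟨m, rfl⟩ := Nat.exists_eq_add_of_le' hm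
  have hne : fibLetter (Nat.fib (m + 2 + 1)) ≠ fibLetter (Nat.fib (m + 2)) := fibLetter_fib_ne m
  simp only [hc] at e7
  cases h1 : fibLetter (Nat.fib (m + 2 + 1)) <;> cases h2 : fibLetter (Nat.fib (m + 2)) <;>
    simp_all

/-- Exactly one palindromic suffix of `𝔽[1, n]` is longer than `n - fib (m + 1)`. -/
theorem reverse_fibFactor_eq_iff_of_le {m n i : ℕ} (hm : 1 ≤ m) (h1 : Nat.fib (m + 2) ≤ n + 1)
    (h2 : n + 1 < Nat.fib (m + 3)) (hi : 1 ≤ i) (hip : i ≤ Nat.fib (m + 1)) :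
    (fibFactor i n).reverse = fibFactor i n ↔ i = Nat.fib (m + 3) - 1 - n := by
  have f2 : Nat.fib (m + 2) = Nat.fib m + Nat.fib (m + 1) := Nat.fib_add_two
  have f3 : Nat.fib (m + 3) = Nat.fib (m + 1) + Nat.fib (m + 2) := Nat.fib_add_two
  have hL : 1 ≤ Nat.fib m := Nat.fib_pos.2 (by omega)
  have hpal : ∀ j, Nat.fib (m + 3) - 1 - n ≤ j → j ≤ n →
      fibLetter j = fibLetter (Nat.fib (m + 3) - 1 - n + n - j) := fun j hj hjn =>
    fibLetter_central (m + 3) (by omega) (by omega) (by omega)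
  -- Reflecting in one palindrome and then in the other translates by `i' - i`. Both contain the
  -- singular window, which would thus also occur at `fib (m + 1) + i - i'`.
  have huniq : ∀ {i i' : ℕ}, 1 ≤ i → i < i' → i' ≤ Nat.fib (m + 1) →
      (∀ j, i ≤ j → j ≤ n → fibLetter j = fibLetter (i + n - j)) →
      (∀ j, i' ≤ j → j ≤ n → fibLetter j = fibLetter (i' + n - j)) → False := by
    intro i i' hi hii hip h h'
    obtain ⟨t, ht, hne⟩ := singular_first_occurrence (m := m)
      (J := Nat.fib (m + 1) + i - i') (by omega) (by omega)
    apply hne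
    rw [h _ (by omega) (by omega), h' (Nat.fib (m + 1) + t) (by omega) (by omega)]
    congr 1
    omega
  rw [reverse_fibFactor_eq_iff]
  constructor
  · intro h
    rcases lt_trichotomy i (Nat.fib (m + 3) - 1 - n) with hlt | heq | hgt
    · exact (huniq hi hlt (by omega) h hpal).elim
    · exact heq
    · exact (huniq (by omega) hgt hip hpal h).elim
  · rintro rfl
    exact hpal

/-- Split the suffixes by whether they start beyond the period `fib (m + 1)`: the later ones shift
back by it, and the earlier ones contribute exactly one. -/
theorem numPalEndingAt_eq_add_one {m n : ℕ} (hm : 1 ≤ m) (h1 : Nat.fib (m + 2) ≤ n + 1)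
    (h2 : n + 1 < Nat.fib (m + 3)) :
    numPalEndingAt n = numPalEndingAt (n - Nat.fib (m + 1)) + 1 := by
  have f2 : Nat.fib (m + 2) = Nat.fib m + Nat.fib (m + 1) := Nat.fib_add_two
  have f3 : Nat.fib (m + 3) = Nat.fib (m + 1) + Nat.fib (m + 2) := Nat.fib_add_two
  have hL : 1 ≤ Nat.fib m := Nat.fib_pos.2 (by omega)
  set p := Nat.fib (m + 1) with hp
  have hper : ∀ t, 1 ≤ t → t ≤ n - p → fibLetter (p + t) = fibLetter t := fun t ht htn =>
    fibLetter_fib_add (m + 1) ht (by show _ ≤ Nat.fib (m + 2); omega)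
  have hsplit : ((Icc 1 n).filter fun i => (fibFactor i n).reverse = fibFactor i n) =
      insert (Nat.fib (m + 3) - 1 - n)
        (((Icc 1 (n - p)).filter fun i =>
          (fibFactor i (n - p)).reverse = fibFactor i (n - p)).map (addLeftEmbedding p)) := by
    ext i
    simp only [mem_filter, mem_Icc, mem_insert, mem_map, addLeftEmbedding_apply]
    have hshift : ∀ s, 1 ≤ s → ((fibFactor (p + s) n).reverse = fibFactor (p + s) n ↔
        (fibFactor s (n - p)).reverse = fibFactor s (n - p)) := by
      intro s hs
      rw [reverse_fibFactor_eq_iff, reverse_fibFactor_eq_iff]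
      constructor
      · intro h j hj hjn
        have e := h (p + j) (by omega) (by omega)
        rw [hper j (by omega) hjn, show p + s + n - (p + j) = p + (s + (n - p) - j) by omega,
          hper _ (by omega) (by omega)] at e
        exact e
      · intro h j hj hjn
        have e := h (j - p) (by omega) (by omega)
        rw [← hper (j - p) (by omega) (by omega), ← hper (s + (n - p) - (j - p)) (by omega)
          (by omega)] at e
        convert e using 2 <;> omega
    rcases le_or_gt i p with hip | hip
    · constructor
      · rintro ⟨⟨hi, -⟩, h⟩
        exact Or.inl ((reverse_fibFactor_eq_iff_of_le hm h1 h2 hi hip).1 h)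
      · rintro (rfl | ⟨s, ⟨⟨hs, -⟩, -⟩, rfl⟩)
        · exact ⟨⟨by omega, by omega⟩,
            (reverse_fibFactor_eq_iff_of_le hm h1 h2 (by omega) hip).2 rfl⟩
        · omega
    · constructor
      · rintro ⟨⟨hi, hin⟩, h⟩
        obtain ⟨s, rfl⟩ := Nat.exists_eq_add_of_le hip.le
        exact Or.inr ⟨s, ⟨⟨by omega, by omega⟩, (hshift s (by omega)).1 h⟩, rfl⟩
      · rintro (rfl | ⟨s, ⟨⟨hs, hsn⟩, h⟩, rfl⟩)
        · omega
        · exact ⟨⟨by omega, by omega⟩, (hshift s hs).2 h⟩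
  have hnot : Nat.fib (m + 3) - 1 - n ∉ (((Icc 1 (n - p)).filter fun i =>
      (fibFactor i (n - p)).reverse = fibFactor i (n - p)).map (addLeftEmbedding p)) := by
    simp only [mem_filter, mem_Icc, mem_map, addLeftEmbedding_apply]
    rintro ⟨s, ⟨⟨hs, -⟩, -⟩, h⟩
    omega
  rw [numPalEndingAt, hsplit, card_insert_of_notMem hnot, card_map, numPalEndingAt]

/-! ### Summation and closed form -/

/-- The number of palindrome occurrences in `𝔽` that end before position `k`, as a rational. -/
def palCount (k : ℕ) : ℚ := ∑ i ∈ range k, (numPalEndingAt i : ℚ)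

theorem palCount_succ (k : ℕ) : palCount (k + 1) = palCount k + numPalEndingAt k :=
  sum_range_succ _ _

theorem cast_sum_Icc_numPalEndingAt {a n : ℕ} (h : a ≤ n + 1) :
    ((∑ i ∈ Icc a n, numPalEndingAt i : ℕ) : ℚ) = palCount (n + 1) - palCount a := by
  rw [← Ico_add_one_right_eq_Icc, Nat.cast_sum, sum_Ico_eq_sub _ h]
  rfl

theorem palCount_recurrence {m n : ℕ} (hm : 1 ≤ m) (h1 : Nat.fib (m + 2) ≤ n + 1)
    (h2 : n + 1 < Nat.fib (m + 3)) :
    palCount (n + 1) - palCount (Nat.fib (m + 2) - 1) =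
      palCount (n - Nat.fib (m + 1) + 1) - palCount (Nat.fib m - 1) + n + 2
        - Nat.fib (m + 2) := by
  have f2 : Nat.fib (m + 2) = Nat.fib m + Nat.fib (m + 1) := Nat.fib_add_two
  have hL : 1 ≤ Nat.fib m := Nat.fib_pos.2 (by omega)
  obtain ⟨d, hd⟩ := Nat.exists_eq_add_of_le h1
  induction d generalizing n with
  | zero =>
    have e : n = Nat.fib (m + 2) - 1 := by omega
    have e' : n - Nat.fib (m + 1) = Nat.fib m - 1 := by omega
    have hq : (n : ℚ) + 1 = Nat.fib (m + 2) := by exact_mod_cast hd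
    rw [palCount_succ, palCount_succ, e', ← e, numPalEndingAt_eq_add_one hm h1 h2, e']
    push_cast
    linarith
  | succ d ih =>
    obtain ⟨n, rfl⟩ : ∃ n', n = n' + 1 := ⟨n - 1, by omega⟩
    have := ih (n := n) (by omega) (by omega) (by omega)
    rw [palCount_succ (n + 1), numPalEndingAt_eq_add_one hm h1 h2,
      show n + 1 - Nat.fib (m + 1) = n - Nat.fib (m + 1) + 1 by omega,
      palCount_succ (n - Nat.fib (m + 1) + 1)]
    push_cast
    linarith

theorem palCount_fib (k : ℕ) : palCount (Nat.fib (k + 1) - 1) =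
    ((k : ℚ) - 4) / 5 * Nat.fib (k + 3) + ((k : ℚ) - 2) / 5 * Nat.fib (k + 1) + 2 := by
  induction k using Nat.strong_induction_on with
  | _ k ih =>
    match k with
    | 0 => norm_num [palCount, Nat.fib_add_two]
    | 1 => norm_num [palCount, Nat.fib_add_two]
    | 2 =>
      have : numPalEndingAt 0 = 0 := rfl
      norm_num [palCount, Nat.fib_add_two, this]
    | k + 3 =>
      have f2 : Nat.fib (k + 2) = Nat.fib k + Nat.fib (k + 1) := Nat.fib_add_two
      have f3 : Nat.fib (k + 3) = Nat.fib (k + 1) + Nat.fib (k + 2) := Nat.fib_add_two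
      have f4 : Nat.fib (k + 4) = Nat.fib (k + 2) + Nat.fib (k + 3) := Nat.fib_add_two
      have f5 : Nat.fib (k + 5) = Nat.fib (k + 3) + Nat.fib (k + 4) := Nat.fib_add_two
      have f6 : Nat.fib (k + 6) = Nat.fib (k + 4) + Nat.fib (k + 5) := Nat.fib_add_two
      have hL : 1 ≤ Nat.fib (k + 1) := Nat.fib_pos.2 (by omega)
      have hL2 : 1 ≤ Nat.fib (k + 2) := Nat.fib_pos.2 (by omega)
      have e0 := ih k (by omega)
      have e2 := ih (k + 2) (by omega)
      -- The largest admissible `n`, so that all four arguments of `palCount` have the form `fib j -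
      -- 1`.
      have r := palCount_recurrence (m := k + 1) (n := Nat.fib (k + 4) - 2) (by omega)
        (by show Nat.fib (k + 3) ≤ _; omega) (by show _ < Nat.fib (k + 4); omega)
      simp only [add_assoc, Nat.reduceAdd] at r e2 ⊢
      have s1 : Nat.fib (k + 4) - 2 + 1 = Nat.fib (k + 4) - 1 := by omega
      have s2 : Nat.fib (k + 4) - 2 - Nat.fib (k + 2) + 1 = Nat.fib (k + 3) - 1 := by omega
      have s3 : ((Nat.fib (k + 4) - 2 : ℕ) : ℚ) = Nat.fib (k + 4) - 2 := by
        rw [Nat.cast_sub (by omega)]; norm_num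
      rw [s1, s2, s3] at r
      have g : palCount (Nat.fib (k + 4) - 1) = 2 * palCount (Nat.fib (k + 3) - 1)
        - palCount (Nat.fib (k + 1) - 1) + Nat.fib (k + 4) - Nat.fib (k + 3) := by linarith
      rw [g, e0, e2, f6, f5, f4, f3, f2]
      push_cast
      ring

theorem sum_numPalEndingAt_of_lt {m n : ℕ} (hm : 1 ≤ m) (h1 : Nat.fib (m + 2) ≤ n + 1)
    (h2 : n + 1 < Nat.fib (m + 3)) :
    ((∑ i ∈ Icc (Nat.fib (m + 2) - 1) n, numPalEndingAt i : ℕ) : ℚ) =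
      ((∑ i ∈ Icc (Nat.fib m - 1) (n - Nat.fib (m + 1)), numPalEndingAt i : ℕ) : ℚ)
        + n - Nat.fib (m + 2) + 2 := by
  have f2 : Nat.fib (m + 2) = Nat.fib m + Nat.fib (m + 1) := Nat.fib_add_two
  rw [cast_sum_Icc_numPalEndingAt (by omega), cast_sum_Icc_numPalEndingAt (by omega),
    palCount_recurrence hm h1 h2]
  ring

/-- The same recurrence, with the right-hand sum started one Fibonacci block later; the omitted
block is a difference of two values of `palCount_fib`. -/
theorem sum_numPalEndingAt_of_ge {m n : ℕ} (h1 : Nat.fib (m + 3) ≤ n + 1)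
    (h2 : n + 1 < Nat.fib (m + 4)) (h3 : 2 * Nat.fib (m + 2) ≤ n + 1) :
    ((∑ i ∈ Icc (Nat.fib (m + 3) - 1) n, numPalEndingAt i : ℕ) : ℚ) =
      ((∑ i ∈ Icc (Nat.fib (m + 2) - 1) (n - Nat.fib (m + 2)), numPalEndingAt i : ℕ) : ℚ)
        + n + ((m : ℚ) + 1 - 11) / 5 * Nat.fib (m + 2)
        + ((m : ℚ) + 1 + 1) / 5 * Nat.fib m + 2 := by
  have f2 : Nat.fib (m + 2) = Nat.fib m + Nat.fib (m + 1) := Nat.fib_add_two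
  have f3 : Nat.fib (m + 3) = Nat.fib (m + 1) + Nat.fib (m + 2) := Nat.fib_add_two
  have f4 : Nat.fib (m + 4) = Nat.fib (m + 2) + Nat.fib (m + 3) := Nat.fib_add_two
  rw [cast_sum_Icc_numPalEndingAt (by omega), cast_sum_Icc_numPalEndingAt (by omega),
    palCount_recurrence (m := m + 1) (by omega) h1 h2]
  have e0 := palCount_fib m
  have e1 := palCount_fib (m + 1)
  simp only [add_assoc, Nat.reduceAdd] at e0 e1 ⊢
  rw [e0, e1, f4, f3, f2]
  push_cast
  ring

/-! ### Correctness and cost of the recursive procedure -/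

theorem recSum_correct (m n : ℕ) (h1 : Nat.fib (m + 2) ≤ n + 1) (h2 : n + 1 < Nat.fib (m + 3)) :
    (recSum m n).1 = ((∑ i ∈ Icc (Nat.fib (m + 2) - 1) n, numPalEndingAt i : ℕ) : ℚ) ∧
      (recSum m n).2 ≤ m := by
  induction m using Nat.strong_induction_on generalizing n with
  | _ m ih =>
    match m with
    | 0 =>
      have hn : n = 0 := by simp [Nat.fib_add_two] at h2; omega
      subst hn
      have : numPalEndingAt 0 = 0 := rfl
      simp [recSum, this]
    | 1 =>
      have hn : n = 1 := by simp [Nat.fib_add_two] at h1 h2; omega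
      subst hn
      have : numPalEndingAt 1 = 1 := rfl
      simp [recSum, this, Nat.fib_add_two]
    | m + 2 =>
      have f2 : Nat.fib (m + 3) = Nat.fib (m + 1) + Nat.fib (m + 2) := Nat.fib_add_two
      have f3 : Nat.fib (m + 4) = Nat.fib (m + 2) + Nat.fib (m + 3) := Nat.fib_add_two
      have f4 : Nat.fib (m + 5) = Nat.fib (m + 3) + Nat.fib (m + 4) := Nat.fib_add_two
      simp only [add_assoc, Nat.reduceAdd] at h1 h2 ⊢
      have hL : 1 ≤ Nat.fib (m + 1) := Nat.fib_pos.2 (by omega)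
      have hL2 : 1 ≤ Nat.fib (m + 2) := Nat.fib_pos.2 (by omega)
      have n1 : fibNum ((m : ℤ) + 1) = Nat.fib (m + 3) := fibNum_eq_fib (by push_cast; ring)
      have n2 : fibNum ((m : ℤ) + 2) = Nat.fib (m + 4) := fibNum_eq_fib (by push_cast; ring)
      have n3 : fibNum ((m : ℤ) - 1) = Nat.fib (m + 1) := fibNum_eq_fib (by push_cast; ring)
      rw [recSum, n1, n2, n3]
      split_ifs with h
      · obtain ⟨c, d⟩ := ih m (by omega) (n - Nat.fib (m + 3)) (by omega) (by omega)
        refine ⟨?_, by dsimp only; omega⟩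
        have e := sum_numPalEndingAt_of_lt (m := m + 2) (by omega) h1 h2
        simp only [add_assoc, Nat.reduceAdd] at e
        dsimp only
        rw [c, e]
      · obtain ⟨c, d⟩ := ih (m + 1) (by omega) (n - Nat.fib (m + 3))
          (by show Nat.fib (m + 3) ≤ _; omega) (by show _ < Nat.fib (m + 4); omega)
        refine ⟨?_, by dsimp only; omega⟩
        have e := sum_numPalEndingAt_of_ge (m := m + 1) h1 h2
          (by show 2 * Nat.fib (m + 3) ≤ _; omega)
        simp only [add_assoc, Nat.reduceAdd] at e c
        dsimp only
        rw [c, e]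
        push_cast
        ring

/-- Fibonacci numbers at least double every two steps. Rounding the exponent up is what yields `m ≤
2 * log` without an additive constant. -/
theorem two_pow_le_fib (m : ℕ) : 2 ^ ((m + 1) / 2) ≤ Nat.fib (m + 2) := by
  induction m using Nat.twoStepInduction with
  | zero => decide
  | one => decide
  | more m ih _ =>
    have f2 : Nat.fib (m + 3) = Nat.fib (m + 1) + Nat.fib (m + 2) := Nat.fib_add_two
    have f3 : Nat.fib (m + 4) = Nat.fib (m + 2) + Nat.fib (m + 3) := Nat.fib_add_two
    rw [show (m + 2 + 1) / 2 = (m + 1) / 2 + 1 by omega, pow_succ]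
    show _ ≤ Nat.fib (m + 4)
    omega

theorem le_two_mul_log {m n : ℕ} (h : Nat.fib (m + 2) ≤ n + 1) : m ≤ 2 * Nat.log 2 (n + 1) := by
  have := Nat.le_log_of_pow_le one_lt_two ((two_pow_le_fib m).trans h)
  omega

theorem numPalOccurrences_eq_palCount (n : ℕ) : (numPalOccurrences n : ℚ) = palCount (n + 1) := by
  have h1 : palCount 1 = 0 := by
    have : numPalEndingAt 0 = 0 := rfl
    simp [palCount, this]
  rw [numPalOccurrences, cast_sum_Icc_numPalEndingAt (by omega), h1, sub_zero]

end FibPal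

theorem corollary6p8 (n m : ℕ) (hn : 1 ≤ n)
    (hm : FibPal.fibNum (m : ℤ) ≤ n + 1) (hm' : n + 1 < FibPal.fibNum ((m : ℤ) + 1)) :
    -- the recursive formula: first case
    (n + 1 < 2 * FibPal.fibNum ((m : ℤ) - 1) →
      ((∑ i ∈ Finset.Icc (FibPal.fibNum (m : ℤ) - 1) n, FibPal.numPalEndingAt i : ℕ) : ℚ)
        = ((∑ i ∈ Finset.Icc (FibPal.fibNum ((m : ℤ) - 2) - 1) (n - FibPal.fibNum ((m : ℤ) - 1)),
              FibPal.numPalEndingAt i : ℕ) : ℚ)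
          + (n : ℚ) - (FibPal.fibNum (m : ℤ) : ℚ) + 2) ∧
    -- the recursive formula: second case
    (2 * FibPal.fibNum ((m : ℤ) - 1) ≤ n + 1 →
      ((∑ i ∈ Finset.Icc (FibPal.fibNum (m : ℤ) - 1) n, FibPal.numPalEndingAt i : ℕ) : ℚ)
        = ((∑ i ∈ Finset.Icc (FibPal.fibNum ((m : ℤ) - 1) - 1) (n - FibPal.fibNum ((m : ℤ) - 1)),
              FibPal.numPalEndingAt i : ℕ) : ℚ)
          + (n : ℚ) + ((m : ℚ) - 11) / 5 * (FibPal.fibNum ((m : ℤ) - 1) : ℚ)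
          + ((m : ℚ) + 1) / 5 * (FibPal.fibNum ((m : ℤ) - 3) : ℚ) + 2) ∧
    -- the sums on the right are again of the same form, for `m - 2` and `m - 1` respectively
    (n + 1 < 2 * FibPal.fibNum ((m : ℤ) - 1) →
      FibPal.fibNum ((m : ℤ) - 2) ≤ n - FibPal.fibNum ((m : ℤ) - 1) + 1 ∧
      n - FibPal.fibNum ((m : ℤ) - 1) + 1 < FibPal.fibNum ((m : ℤ) - 1)) ∧
    (2 * FibPal.fibNum ((m : ℤ) - 1) ≤ n + 1 →
      FibPal.fibNum ((m : ℤ) - 1) ≤ n - FibPal.fibNum ((m : ℤ) - 1) + 1 ∧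
      n - FibPal.fibNum ((m : ℤ) - 1) + 1 < FibPal.fibNum (m : ℤ)) ∧
    -- the algorithm for `B(n)`: it is correct and makes `O(log n)` recursive calls
    (FibPal.numPalOccurrences n : ℚ)
      = ((m : ℚ) - 3) / 5 * (FibPal.fibNum ((m : ℤ) + 2) : ℚ)
        + ((m : ℚ) - 1) / 5 * (FibPal.fibNum (m : ℤ) : ℚ) + 2 + (FibPal.recSum m n).1 ∧
    (FibPal.recSum m n).1
      = ((∑ i ∈ Finset.Icc (FibPal.fibNum (m : ℤ) - 1) n, FibPal.numPalEndingAt i : ℕ) : ℚ) ∧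
    (FibPal.recSum m n).2 ≤ m ∧ m ≤ 2 * Nat.log 2 (n + 1) := by
  -- `m = 0` would force `n = 0`; with `m = k + 1` every index, down to `m - 3`, becomes a natural
  -- `Nat.fib` index.
  obtain ⟨k, rfl⟩ : ∃ k, m = k + 1 := by
    rcases m with _ | k
    · have : FibPal.fibNum (((0 : ℕ) : ℤ) + 1) = 2 := rfl
      omega
    · exact ⟨k, rfl⟩
  have n0 : FibPal.fibNum ((k + 1 : ℕ) : ℤ) = Nat.fib (k + 3) :=
    FibPal.fibNum_eq_fib (by push_cast; ring)
  have n1 : FibPal.fibNum (((k + 1 : ℕ) : ℤ) + 1) = Nat.fib (k + 4) :=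
    FibPal.fibNum_eq_fib (by push_cast; ring)
  have n2 : FibPal.fibNum (((k + 1 : ℕ) : ℤ) + 2) = Nat.fib (k + 5) :=
    FibPal.fibNum_eq_fib (by push_cast; ring)
  have p1 : FibPal.fibNum (((k + 1 : ℕ) : ℤ) - 1) = Nat.fib (k + 2) :=
    FibPal.fibNum_eq_fib (by push_cast; ring)
  have p2 : FibPal.fibNum (((k + 1 : ℕ) : ℤ) - 2) = Nat.fib (k + 1) :=
    FibPal.fibNum_eq_fib (by push_cast; ring)
  have p3 : FibPal.fibNum (((k + 1 : ℕ) : ℤ) - 3) = Nat.fib k :=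
    FibPal.fibNum_eq_fib (by push_cast; ring)
  rw [n0] at hm
  rw [n1] at hm'
  rw [n0, n2, p1, p2, p3]
  have f3 : Nat.fib (k + 3) = Nat.fib (k + 1) + Nat.fib (k + 2) := Nat.fib_add_two
  have f4 : Nat.fib (k + 4) = Nat.fib (k + 2) + Nat.fib (k + 3) := Nat.fib_add_two
  obtain ⟨hrec, hcalls⟩ := FibPal.recSum_correct (k + 1) n hm hm'
  refine ⟨fun _ => FibPal.sum_numPalEndingAt_of_lt (by omega) hm hm', fun h => ?_,
    fun h => ⟨by omega, by omega⟩, fun h => ⟨by omega, by omega⟩, ?_, hrec, hcalls,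
    FibPal.le_two_mul_log hm⟩
  · rw [FibPal.sum_numPalEndingAt_of_ge hm hm' h]
    push_cast
    ring
  -- `B(n)` is the closed form up to `f_m - 2` plus the sum from `f_m - 1`; including `A(0) = 0`
  -- changes nothing.
  · have e := FibPal.palCount_fib (k + 2)
    simp only [add_assoc, Nat.reduceAdd] at e hrec
    rw [hrec, FibPal.numPalOccurrences_eq_palCount,
      FibPal.cast_sum_Icc_numPalEndingAt (by omega), e]
    push_cast
    ring
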